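/- Let $d\ge 0$ be an integer, let $\mathcal{O}\subset\mathbb{R}^d$ be a non-empty finite set of parameters, $\mathcal{A}$ a finite set of actions, and $\mathcal{X}$ a measurable space of contexts. A Bayesian contextual bandit problem $\Phi$ consists of a prior $\mathbb{P}_\Theta$ on $\mathcal{O}$, a context distribution $\mathbb{P}_X$ on $\mathcal{X}$ and a reward kernel that gives, for all $(x,a,\theta)$, the law of the random reward $R(x,a,\theta)$. The parameter $\Theta\sim\mathbb{P}_\Theta$ is drawn once. In each round $t=1,\dots,T$ a context $X_t\sim\mathbb{P}_X$ is drawn independently of $\Theta$ and of the past, an action $A_t\in\mathcal{A}$ is chosen, and the reward $R_t=R(X_t,A_t,\Theta)$ is drawn from the reward kernel, conditionally independently of the past given $(X_t,A_t,\Theta)$. Let $R^\star_\Phi=\sup_\psi\mathbb{E}\big[\sum_{t=1}^T R(X_t,\psi(X_t,\Theta),\Theta)\big]$, where the supremum is over the measurable decision rules $\psi:\mathcal{X}\times\mathcal{O}\to\mathcal{A}$ for which the expectation is defined, and let $\psi^\star$ be a decision rule that attains it. Thompson Sampling proceeds as follows: in round $t$, it samples $\hat\Theta_t$ from the posterior $\mathbb{P}_{\Theta\mid\hat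 H^t}$ of the parameter given the history $\hat H^t$ of the contexts, actions and rewards of the rounds before $t$ (conditionally on $\hat H^t$, independently of $\Theta$ and $X_t$), and plays $\hat A_t=\psi^\star(X_t,\hat\Theta_t)$. Its regret after $T$ rounds is $$\mathrm{REG}^{\mathrm{TS}}_\Phi=R^\star_\Phi-\mathbb{E}\Big[\sum_{t=1}^T R(X_t,\hat A_t,\Theta)\Big].$$ Assume that for all $(x,a,\theta)$ the reward $R(x,a,\theta)$ lies in $[0,L]$ almost surely and that $\mathbb{E}[R(x,a,\theta)]=\langle\theta,m(x,a)\rangle$ for some feature map $m:\mathcal{X}\times\mathcal{A}\to\mathbb{R}^d$. Then $$\mathrm{REG}^{\mathrm{TS}}_\Phi\le\sqrt{\frac{L^2\,d\,T\log|\mathcal{O}|}{2}}.$$ -/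

import Mathlib

open MeasureTheory ProbabilityTheory

noncomputable section

/-- A Bayesian contextual bandit problem with contexts in `𝒳`, actions in `𝒜` and environment
parameters in `𝒪`: a prior on the parameters, a context distribution and a reward kernel. -/
structure ContextualBandit (𝒳 𝒜 𝒪 : Type*)
    [MeasurableSpace 𝒳] [MeasurableSpace 𝒜] [MeasurableSpace 𝒪] where
  /-- the law of the environment parameter `Θ` -/
  prior : Measure 𝒪
  /-- the law of each context `X_t` -/
  context : Measure 𝒳
  /-- the law of the reward `R_t` given `(X_t, A_t, Θ)` -/
  reward : Kernel (𝒳 × 𝒜 × 𝒪) ℝ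
  prior_prob : IsProbabilityMeasure prior
  context_prob : IsProbabilityMeasure context
  reward_markov : IsMarkovKernel reward

namespace ContextualBandit

attribute [instance] prior_prob context_prob reward_markov

/-- The data collected in the first `t` rounds: for each of them the context, the action and
the reward. -/
abbrev History (𝒳 𝒜 : Type*) (t : ℕ) : Type _ := Fin t → (𝒳 × 𝒜) × ℝ

section Interaction

variable {𝒳 𝒜 𝒪 : Type*} [MeasurableSpace 𝒳] [MeasurableSpace 𝒜] [MeasurableSpace 𝒪]

/-- Append the data of a new round to the history. -/
def append {t : ℕ} (p : (𝒪 × History 𝒳 𝒜 t) × ((𝒳 × 𝒜) × ℝ)) : 𝒪 × History 𝒳 𝒜 (t + 1) :=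
  (p.1.1, Fin.snoc (α := fun _ => (𝒳 × 𝒜) × ℝ) p.1.2 p.2)

theorem measurable_append {t : ℕ} :
    Measurable (append : (𝒪 × History 𝒳 𝒜 t) × ((𝒳 × 𝒜) × ℝ) → 𝒪 × History 𝒳 𝒜 (t + 1)) := by
  refine Measurable.prodMk (by fun_prop) (measurable_pi_iff.2 fun i => ?_)
  refine Fin.lastCases ?_ (fun j => ?_) i
  · simpa using measurable_snd
  · simp only [Fin.snoc_castSucc]
    fun_prop

/-- A rule for choosing the action of round `t` (counted from `0`), possibly at random, from the
environment parameter, the history and the current context. Policies and oracle decision rules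
are both special cases. -/
abbrev Strategy (𝒳 𝒜 𝒪 : Type*)
    [MeasurableSpace 𝒳] [MeasurableSpace 𝒜] [MeasurableSpace 𝒪] : Type _ :=
  ∀ t : ℕ, Kernel ((𝒪 × History 𝒳 𝒜 t) × 𝒳) 𝒜

/-- A (possibly randomized) policy: the action depends on the history and the current context. -/
abbrev Policy (𝒳 𝒜 : Type*) [MeasurableSpace 𝒳] [MeasurableSpace 𝒜] : Type _ :=
  ∀ t : ℕ, Kernel (History 𝒳 𝒜 t × 𝒳) 𝒜

/-- A policy, seen as a strategy that ignores the environment parameter. -/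
def Policy.blind (𝒪 : Type*) [MeasurableSpace 𝒪] (φ : Policy 𝒳 𝒜) : Strategy 𝒳 𝒜 𝒪 :=
  fun t => (φ t).comap (fun p => (p.1.2, p.2)) (by fun_prop)

/-- The strategy that plays `ψ (X_t, Θ)` in every round. -/
def oracle (ψ : 𝒳 × 𝒪 → 𝒜) (hψ : Measurable ψ) : Strategy 𝒳 𝒜 𝒪 :=
  fun _ => Kernel.deterministic (fun p => ψ (p.2, p.1.1)) (hψ.comp (by fun_prop))

instance (𝒪 : Type*) [MeasurableSpace 𝒪] (φ : Policy 𝒳 𝒜) [∀ t, IsMarkovKernel (φ t)] (t : ℕ) :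
    IsMarkovKernel (φ.blind 𝒪 t) := by
  unfold Policy.blind; infer_instance

instance (ψ : 𝒳 × 𝒪 → 𝒜) (hψ : Measurable ψ) (t : ℕ) :
    IsMarkovKernel (oracle ψ hψ t) := by
  unfold oracle; infer_instance

variable (Φ : ContextualBandit 𝒳 𝒜 𝒪)

/-- One round: given the parameter and the history, the context is drawn from the context
distribution (independently of both), the action is drawn from `σ`, and the reward is drawn from
the reward kernel. -/
def round {t : ℕ} (σ : Kernel ((𝒪 × History 𝒳 𝒜 t) × 𝒳) 𝒜) :
    Kernel (𝒪 × History 𝒳 𝒜 t) ((𝒳 × 𝒜) × ℝ) :=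
  ((Kernel.const _ Φ.context).compProd σ).compProd
    (Φ.reward.comap (fun p => (p.2.1, p.2.2, p.1.1)) (by fun_prop))

instance {t : ℕ} (σ : Kernel ((𝒪 × History 𝒳 𝒜 t) × 𝒳) 𝒜) [IsMarkovKernel σ] :
    IsMarkovKernel (Φ.round σ) := by
  unfold round; infer_instance

/-- The joint law of the parameter and the empty history. -/
def initial : Measure (𝒪 × History 𝒳 𝒜 0) :=
  Φ.prior.map (fun θ => (θ, Fin.elim0))

instance : IsProbabilityMeasure Φ.initial :=
  Measure.isProbabilityMeasure_map (by fun_prop)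

/-- The joint law of the parameter and the history after one more round. -/
def extend {t : ℕ} (ρ : Measure (𝒪 × History 𝒳 𝒜 t))
    (σ : Kernel ((𝒪 × History 𝒳 𝒜 t) × 𝒳) 𝒜) : Measure (𝒪 × History 𝒳 𝒜 (t + 1)) :=
  (ρ.compProd (Φ.round σ)).map append

instance {t : ℕ} (ρ : Measure (𝒪 × History 𝒳 𝒜 t)) [IsProbabilityMeasure ρ]
    (σ : Kernel ((𝒪 × History 𝒳 𝒜 t) × 𝒳) 𝒜) [IsMarkovKernel σ] :
    IsProbabilityMeasure (Φ.extend ρ σ) :=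
  Measure.isProbabilityMeasure_map measurable_append.aemeasurable

/-- The joint law of the parameter and of the history of the first `t` rounds, when the actions
are chosen by `σ`. -/
def law (σ : Strategy 𝒳 𝒜 𝒪) : ∀ t : ℕ, Measure (𝒪 × History 𝒳 𝒜 t)
  | 0 => Φ.initial
  | t + 1 => Φ.extend (law σ t) (σ t)

instance law_prob (σ : Strategy 𝒳 𝒜 𝒪) [∀ t, IsMarkovKernel (σ t)] (t : ℕ) :
    IsProbabilityMeasure (Φ.law σ t) := by
  induction t with
  | zero => unfold law; infer_instance
  | succ t ih => unfold law; infer_instance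

/-- The sum of the rewards collected in a history of `T` rounds. -/
def totalReward {T : ℕ} (p : 𝒪 × History 𝒳 𝒜 T) : ℝ := ∑ t : Fin T, (p.2 t).2

/-- The expected cumulative reward of `σ` in `T` rounds. -/
def cumulativeReward (T : ℕ) (σ : Strategy 𝒳 𝒜 𝒪) : ℝ :=
  ∫ p, totalReward p ∂(Φ.law σ T)

/-- The decision rules `𝒳 × 𝒪 → 𝒜` whose expected cumulative reward is defined. -/
structure IsAdmissible (T : ℕ) (ψ : 𝒳 × 𝒪 → 𝒜) : Prop where
  measurable : Measurable ψ
  integrable : Integrable totalReward (Φ.law (oracle ψ measurable) T)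

/-- The optimal cumulative reward: the supremum over the decision rules that know the parameter. -/
def optimalReward (T : ℕ) : ℝ :=
  ⨆ ψ : {ψ : 𝒳 × 𝒪 → 𝒜 // Φ.IsAdmissible T ψ},
    Φ.cumulativeReward T (oracle ψ.1 ψ.2.measurable)

/-- `ψ` is a decision rule that achieves the optimal cumulative reward. -/
structure IsOptimal (T : ℕ) (ψ : 𝒳 × 𝒪 → 𝒜) : Prop extends Φ.IsAdmissible T ψ where
  le : ∀ (χ : 𝒳 × 𝒪 → 𝒜) (hχ : Φ.IsAdmissible T χ),
    Φ.cumulativeReward T (oracle χ hχ.measurable) ≤ Φ.cumulativeReward T (oracle ψ measurable)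

/-- The Bayesian expected regret of a policy after `T` rounds. -/
def regret (T : ℕ) (φ : Policy 𝒳 𝒜) : ℝ :=
  Φ.optimalReward T - Φ.cumulativeReward T (φ.blind 𝒪)

/-- Given the history and the context `x`, sample `θ'` from the kernel `π` at the history
(independently of everything else) and play `ψ (x, θ')`. -/
def sampleAndPlay (ψ : 𝒳 × 𝒪 → 𝒜) {t : ℕ} (π : Kernel (History 𝒳 𝒜 t) 𝒪) :
    Kernel (History 𝒳 𝒜 t × 𝒳) 𝒜 :=
  (Kernel.id ×ₖ π.prodMkRight 𝒳).map (fun q => ψ (q.1.2, q.2))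

theorem sampleAndPlay_apply {ψ : 𝒳 × 𝒪 → 𝒜} (hψ : Measurable ψ) {t : ℕ}
    (π : Kernel (History 𝒳 𝒜 t) 𝒪) [IsMarkovKernel π] (h : History 𝒳 𝒜 t) (x : 𝒳) :
    sampleAndPlay ψ π (h, x) = (π h).map (fun θ => ψ (x, θ)) := by
  have h1 : Measurable (fun q : (History 𝒳 𝒜 t × 𝒳) × 𝒪 => ψ (q.1.2, q.2)) :=
    hψ.comp (by fun_prop)
  rw [sampleAndPlay, Kernel.map_apply _ h1, Kernel.prod_apply, Kernel.id_apply,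
    Kernel.prodMkRight_apply, Measure.dirac_prod, Measure.map_map h1 (by fun_prop)]
  rfl

theorem sampleAndPlay_markov {ψ : 𝒳 × 𝒪 → 𝒜} (hψ : Measurable ψ) {t : ℕ}
    (π : Kernel (History 𝒳 𝒜 t) 𝒪) [IsMarkovKernel π] : IsMarkovKernel (sampleAndPlay ψ π) :=
  Kernel.IsMarkovKernel.map _ (hψ.comp (by fun_prop))

end Interaction

section Thompson

variable {𝒳 𝒜 𝒪 : Type*} [MeasurableSpace 𝒳] [MeasurableSpace 𝒜]
  [MeasurableSpace 𝒪] [StandardBorelSpace 𝒪] [Nonempty 𝒪]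

/-- The posterior: the regular conditional distribution of the parameter given the history, when
`ρ` is their joint law. -/
def posterior {t : ℕ} (ρ : Measure (𝒪 × History 𝒳 𝒜 t)) [IsFiniteMeasure ρ] :
    Kernel (History 𝒳 𝒜 t) 𝒪 :=
  (ρ.map Prod.swap).condKernel

instance {t : ℕ} (ρ : Measure (𝒪 × History 𝒳 𝒜 t)) [IsFiniteMeasure ρ] :
    IsMarkovKernel (posterior ρ) := by
  unfold posterior; infer_instance

variable (Φ : ContextualBandit 𝒳 𝒜 𝒪)

/-- The joint law of the parameter and of the history collected by Thompson Sampling. -/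
def thompsonLaw (ψ : 𝒳 × 𝒪 → 𝒜) (hψ : Measurable ψ) :
    ∀ t : ℕ, {ρ : Measure (𝒪 × History 𝒳 𝒜 t) // IsProbabilityMeasure ρ}
  | 0 => ⟨Φ.initial, inferInstance⟩
  | t + 1 =>
    let ρ := thompsonLaw ψ hψ t
    haveI := ρ.2
    haveI := sampleAndPlay_markov hψ (posterior ρ.1)
    ⟨Φ.extend ρ.1 ((sampleAndPlay ψ (posterior ρ.1)).comap (fun p => (p.1.2, p.2)) (by fun_prop)),
      inferInstance⟩

instance (ψ : 𝒳 × 𝒪 → 𝒜) (hψ : Measurable ψ) (t : ℕ) :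
    IsProbabilityMeasure (Φ.thompsonLaw ψ hψ t).1 := (Φ.thompsonLaw ψ hψ t).2

/-- Thompson Sampling with the decision rule `ψ`: in each round, sample a parameter from the
posterior given the history collected so far and play `ψ` for it and the current context. -/
def thompson (ψ : 𝒳 × 𝒪 → 𝒜) (hψ : Measurable ψ) : Policy 𝒳 𝒜 :=
  fun t => sampleAndPlay ψ (posterior (Φ.thompsonLaw ψ hψ t).1)

instance (ψ : 𝒳 × 𝒪 → 𝒜) (hψ : Measurable ψ) (t : ℕ) :
    IsMarkovKernel (Φ.thompson ψ hψ t) :=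
  sampleAndPlay_markov hψ _

/-- `thompsonLaw` is the law of the interaction with the policy `thompson`. -/
theorem law_thompson (ψ : 𝒳 × 𝒪 → 𝒜) (hψ : Measurable ψ) (t : ℕ) :
    Φ.law ((Φ.thompson ψ hψ).blind 𝒪) t = (Φ.thompsonLaw ψ hψ t).1 := by
  induction t with
  | zero => rfl
  | succ t ih => rw [law, ih]; rfl

/-- Thompson Sampling samples from the posterior under the law that it induces itself. -/
theorem thompson_apply (ψ : 𝒳 × 𝒪 → 𝒜) (hψ : Measurable ψ) (t : ℕ)
    (h : History 𝒳 𝒜 t) (x : 𝒳) :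
    Φ.thompson ψ hψ t (h, x) =
      (posterior (Φ.law ((Φ.thompson ψ hψ).blind 𝒪) t) h).map (fun θ => ψ (x, θ)) := by
  simp only [law_thompson]
  exact sampleAndPlay_apply hψ _ h x

end Thompson

end ContextualBandit

end

/-! The gap of a parameter at an action is its mean reward minus the posterior mean reward. Two
estimates on squared gaps give the bound.

Regret is controlled by gaps: given history and context, the sampled parameter has the same
posterior law `p` as `Θ`, so the regret of a round is the diagonal sum `∑ p i * ⟨w i, m i⟩`, with `w
i` the centred parameters and `m i` the features of the action played for `i`. The expected squared
gap at the action played is `∑∑ p i * p j * ⟨w i, m j⟩ ^ 2`. These are the trace and squared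
Frobenius norm of a matrix of rank at most `d`, so the squared regret is at most `d` times the
squared gap (`sq_sum_inner_le_finrank_mul`).

Gaps are controlled by information: summed over the rounds, the expected squared gaps are at most `L
^ 2 * log |𝒪| / 2` for every policy (`sum_integral_gap_sq_le`). Exponential supermartingales built
from Hoeffding's lemma, one per parameter, play the role of mutual information and Pinsker's
inequality.

The estimates are joined through `y ≤ 1 / (2 * η) + η / 2 * y ^ 2`, with `η` optimised once after
summation. -/

/-! ### Trace inequality and elementary bounds. -/

/-- In an eigenbasis of the second-moment operator of the `w i`, the diagonal sum splits into
`finrank` coordinate sums. Cauchy–Schwarz over the coordinates gives the dimension; Cauchy–Schwarz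
over `i` within each gives the eigenvalue `α k`, and the `α k` reassemble into the quadratic form at
each `m j`. -/
theorem sq_sum_inner_le_finrank_mul {ι E : Type*} [Fintype ι] [NormedAddCommGroup E]
    [InnerProductSpace ℝ E] [FiniteDimensional ℝ E] (p : ι → ℝ) (hp : ∀ i, 0 ≤ p i)
    (w m : ι → E) :
    (∑ i, p i * inner ℝ (w i) (m i)) ^ 2 ≤
      Module.finrank ℝ E * ∑ i, ∑ j, p i * p j * inner ℝ (w i) (m j) ^ 2 := by
  let A : E →ₗ[ℝ] E := ∑ i, p i • (innerₛₗ ℝ (w i)).smulRight (w i)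
  have hA (u v : E) : inner ℝ (A u) v = ∑ i, p i * (inner ℝ (w i) u * inner ℝ (w i) v) := by
    simp [A, sum_inner, inner_smul_left]
  have hS : A.IsSymmetric := fun u v => by
    rw [hA, real_inner_comm, hA]
    exact Finset.sum_congr rfl fun i _ => by ring
  let e := hS.eigenvectorBasis rfl
  let α := hS.eigenvalues rfl
  have he (k) : A (e k) = α k • e k := hS.apply_eigenvectorBasis rfl k
  have hα (k) : α k = ∑ i, p i * inner ℝ (w i) (e k) ^ 2 := by
    have h := hA (e k) (e k)
    rw [he, inner_smul_left, real_inner_self_eq_norm_sq, e.orthonormal.1 k] at h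
    simpa [pow_two] using h
  have hexp (u v : E) : inner ℝ u v = ∑ k, inner ℝ u (e k) * inner ℝ v (e k) := by
    rw [← e.sum_inner_mul_inner u v]
    simp_rw [real_inner_comm v]
  have hquad (v : E) : ∑ i, p i * inner ℝ (w i) v ^ 2 = ∑ k, α k * inner ℝ v (e k) ^ 2 := by
    have h := hA v v
    rw [hexp] at h
    simp_rw [pow_two]
    rw [← h]
    refine Finset.sum_congr rfl fun k _ => ?_
    rw [hS, he, inner_smul_right]
    ring
  have hdiag : ∑ i, p i * inner ℝ (w i) (m i) =
      ∑ k, ∑ i, p i * (inner ℝ (w i) (e k) * inner ℝ (m i) (e k)) := by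
    rw [Finset.sum_comm]
    refine Finset.sum_congr rfl fun i _ => ?_
    rw [hexp, Finset.mul_sum]
  have hcs (k) : (∑ i, p i * (inner ℝ (w i) (e k) * inner ℝ (m i) (e k))) ^ 2 ≤
      α k * ∑ i, p i * inner ℝ (m i) (e k) ^ 2 := by
    rw [hα]
    refine Finset.sum_sq_le_sum_mul_sum_of_sq_le_mul _ (fun i _ => ?_) (fun i _ => ?_)
      fun i _ => le_of_eq (by ring)
    · exact mul_nonneg (hp i) (sq_nonneg _)
    · exact mul_nonneg (hp i) (sq_nonneg _)
  calc (∑ i, p i * inner ℝ (w i) (m i)) ^ 2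
      ≤ Module.finrank ℝ E *
        ∑ k, (∑ i, p i * (inner ℝ (w i) (e k) * inner ℝ (m i) (e k))) ^ 2 := by
        rw [hdiag]
        simpa using sq_sum_le_card_mul_sum_sq (s := Finset.univ)
          (f := fun k => ∑ i, p i * (inner ℝ (w i) (e k) * inner ℝ (m i) (e k)))
    _ ≤ Module.finrank ℝ E * ∑ k, α k * ∑ i, p i * inner ℝ (m i) (e k) ^ 2 := by
        gcongr with k; exact hcs k
    _ = Module.finrank ℝ E * ∑ i, ∑ j, p i * p j * inner ℝ (w i) (m j) ^ 2 := by
        congr 1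
        rw [Finset.sum_comm]
        simp_rw [Finset.mul_sum]
        rw [Finset.sum_comm]
        refine Finset.sum_congr rfl fun j _ => ?_
        rw [← Finset.sum_congr rfl fun i _ => (mul_left_comm (p j) (p i) _).trans
          (mul_assoc (p i) (p j) _).symm, ← Finset.mul_sum, hquad, Finset.mul_sum]
        exact Finset.sum_congr rfl fun k _ => by ring

theorem le_sqrt_of_forall_le_div_add_mul {x a b : ℝ} (ha : 0 ≤ a) (hb : 0 ≤ b)
    (h : ∀ η > 0, x ≤ a / (2 * η) + η / 2 * b) : x ≤ √(a * b) := by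
  rcases le_or_gt x 0 with hx | hx
  · exact hx.trans (Real.sqrt_nonneg _)
  apply Real.le_sqrt_of_sq_le
  -- The choice `η = x / b` gives `x / 2 ≤ a * b / (2 * x)` without square roots. For `b = 0` a
  -- large `η` contradicts `0 < x`.
  rcases hb.eq_or_lt with rfl | hb
  · have h1 := h ((a + 1) / x) (by positivity)
    have : a / (2 * ((a + 1) / x)) < x := by
      rw [div_lt_iff₀ (by positivity)]
      have : x * (2 * ((a + 1) / x)) = 2 * (a + 1) := by field_simp
      linarith
    linarith
  · have h1 := h (x / b) (by positivity)
    have h2 : a / (2 * (x / b)) = a * b / (2 * x) := by field_simp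
    have h3 : x / b / 2 * b = x / 2 := by field_simp
    rw [h2, h3] at h1
    have : x / 2 ≤ a * b / (2 * x) := by linarith
    rw [le_div_iff₀ (by positivity)] at this
    nlinarith

-- This is `F i ≤ log ∑ exp (F j)` with the logarithm replaced by its tangent at `card ι`, so that
-- expectations can be taken term by term.
open Finset in
theorem le_sum_exp_div_card_add_log_card {ι : Type*} [Fintype ι] (F : ι → ℝ) (i : ι) :
    F i ≤ (∑ j, Real.exp (F j)) / Fintype.card ι - 1 + Real.log (Fintype.card ι) := by
  have : Nonempty ι := ⟨i⟩
  have hN : (0 : ℝ) < Fintype.card ι := by exact_mod_cast Fintype.card_pos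
  have h1 := Real.add_one_le_exp (F i - Real.log (Fintype.card ι))
  rw [Real.exp_sub, Real.exp_log hN] at h1
  have h2 : Real.exp (F i) / Fintype.card ι ≤ (∑ j, Real.exp (F j)) / Fintype.card ι := by
    gcongr
    exact single_le_sum (f := fun j => Real.exp (F j)) (fun j _ => (Real.exp_pos _).le) (mem_univ i)
  linarith

theorem MeasureTheory.abs_integral_le_of_ae {α : Type*} [MeasurableSpace α] {μ : Measure α}
    [IsProbabilityMeasure μ] {f : α → ℝ} {C : ℝ} (h : ∀ᵐ x ∂μ, |f x| ≤ C) : |∫ x, f x ∂μ| ≤ C := by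
  simpa using norm_integral_le_of_norm_le_const (f := f) h

theorem MeasureTheory.integral_le_of_forall_le {α : Type*} [MeasurableSpace α] {μ : Measure α}
    [IsProbabilityMeasure μ] {f : α → ℝ} {C : ℝ} (hC : 0 ≤ C) (hf : ∀ x, f x ≤ C) :
    ∫ x, f x ∂μ ≤ C := by
  by_cases hi : Integrable f μ
  · simpa using integral_mono hi (integrable_const C) hf
  -- The integral of a non-integrable function is `0`, which is where `0 ≤ C` enters.
  · rwa [integral_undef hi]

theorem Measurable.integral_kernel_prod_right {α β : Type*} [MeasurableSpace α] [MeasurableSpace β]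
    {κ : Kernel α β} [IsSFiniteKernel κ] {f : α × β → ℝ} (hf : Measurable f) :
    Measurable fun a => ∫ b, f (a, b) ∂κ a :=
  hf.stronglyMeasurable.integral_kernel_prod_right'.measurable

/-! ### Expected rewards along the interaction. -/

namespace ContextualBandit

variable {𝒳 𝒜 𝒪 : Type*} [MeasurableSpace 𝒳] [MeasurableSpace 𝒜] [MeasurableSpace 𝒪]
variable (Φ : ContextualBandit 𝒳 𝒜 𝒪) {L : ℝ}

/-- The mean reward of an action in a context, under an environment parameter. -/
noncomputable def meanReward (y : 𝒳 × 𝒜 × 𝒪) : ℝ := ∫ r, r ∂Φ.reward y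

/-- All rewards lie in `[0, L]` almost surely. -/
def RewardBounded (L : ℝ) : Prop := ∀ y, ∀ᵐ r ∂Φ.reward y, r ∈ Set.Icc 0 L

@[fun_prop]
theorem measurable_meanReward : Measurable Φ.meanReward :=
  (stronglyMeasurable_id.integral_kernel (κ := Φ.reward)).measurable

namespace RewardBounded

variable {Φ} (hL : Φ.RewardBounded L)
include hL

theorem integrable (y : 𝒳 × 𝒜 × 𝒪) : Integrable (fun r => r) (Φ.reward y) :=
  Integrable.of_mem_Icc 0 L aemeasurable_id (hL y)

theorem meanReward_mem (y : 𝒳 × 𝒜 × 𝒪) : Φ.meanReward y ∈ Set.Icc 0 L := by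
  refine ⟨integral_nonneg_of_ae ((hL y).mono fun r hr => hr.1), ?_⟩
  simpa [meanReward] using integral_mono_ae (hL.integrable y) (integrable_const L) ((hL y).mono fun r hr => hr.2)

theorem ae_round {t : ℕ} (σ : Kernel ((𝒪 × History 𝒳 𝒜 t) × 𝒳) 𝒜) (p : 𝒪 × History 𝒳 𝒜 t) :
    ∀ᵐ z ∂Φ.round σ p, z.2 ∈ Set.Icc 0 L :=
  Kernel.ae_compProd_of_ae_ae (measurable_snd measurableSet_Icc) (ae_of_all _ fun _ => hL _)

theorem integral_round {t : ℕ} (σ : Kernel ((𝒪 × History 𝒳 𝒜 t) × 𝒳) 𝒜) [IsMarkovKernel σ]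
    (p : 𝒪 × History 𝒳 𝒜 t) {v : (𝒳 × 𝒜) × ℝ → ℝ} (hv : Measurable v) {C : ℝ}
    (hC : ∀ z, z.2 ∈ Set.Icc 0 L → |v z| ≤ C) :
    ∫ z, v z ∂Φ.round σ p =
      ∫ x, ∫ a, ∫ r, v ((x, a), r) ∂Φ.reward (x, a, p.1) ∂σ (p, x) ∂Φ.context := by
  have h1 : Integrable v (Φ.round σ p) :=
    Integrable.of_bound hv.aestronglyMeasurable C ((hL.ae_round σ p).mono hC)
  rw [round] at h1 ⊢
  rw [ProbabilityTheory.integral_compProd h1, ProbabilityTheory.integral_compProd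
    (h1.integral_compProd)]
  simp [Kernel.comap_apply]

/-- One-round recursion for additive functionals of the history, applied to both the total reward
and the score. The increment need only be bounded for rewards in `[0, L]`, which carry all the mass.
-/
theorem integral_extend {t : ℕ} (ρ : Measure (𝒪 × History 𝒳 𝒜 t)) [IsProbabilityMeasure ρ]
    (σ : Kernel ((𝒪 × History 𝒳 𝒜 t) × 𝒳) 𝒜) [IsMarkovKernel σ]
    {w : 𝒪 × History 𝒳 𝒜 (t + 1) → ℝ} (hw : Measurable w)
    {u : 𝒪 × History 𝒳 𝒜 t → ℝ} (hu : Integrable u ρ)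
    {v : (𝒪 × History 𝒳 𝒜 t) × ((𝒳 × 𝒜) × ℝ) → ℝ} (hv : Measurable v) {C : ℝ}
    (hC : ∀ q, q.2.2 ∈ Set.Icc 0 L → |v q| ≤ C) (h : ∀ q, w (append q) = u q.1 + v q) :
    Integrable w (Φ.extend ρ σ) ∧ ∫ q, w q ∂Φ.extend ρ σ = ∫ p, u p ∂ρ +
      ∫ p, ∫ x, ∫ a, ∫ r, v (p, ((x, a), r)) ∂Φ.reward (x, a, p.1) ∂σ (p, x) ∂Φ.context ∂ρ := by
  have h1 : Integrable v (ρ.compProd (Φ.round σ)) :=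
    Integrable.of_bound hv.aestronglyMeasurable C
      (Measure.ae_compProd_of_ae_ae (measurableSet_le hv.norm measurable_const)
        (ae_of_all _ fun p => (hL.ae_round σ p).mono fun z hz => hC (p, z) hz))
  have hfst : Measure.map Prod.fst (ρ.compProd (Φ.round σ)) = ρ := Measure.fst_compProd _ _
  have h2 : Integrable (fun q => u q.1) (ρ.compProd (Φ.round σ)) :=
    Integrable.comp_measurable (g := u) (by rwa [hfst]) measurable_fst
  constructor
  · rw [extend, integrable_map_measure hw.aestronglyMeasurable measurable_append.aemeasurable]
    exact (h2.add h1).congr (ae_of_all _ fun q => (h q).symm)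
  · rw [extend, integral_map measurable_append.aemeasurable hw.aestronglyMeasurable]
    simp_rw [h]
    rw [integral_add h2 h1, Measure.integral_compProd h1]
    congr 1
    · conv_rhs => rw [← hfst]
      exact (integral_map measurable_fst.aemeasurable (by rw [hfst]; exact hu.1)).symm
    · exact integral_congr_ae (ae_of_all _ fun p =>
        hL.integral_round σ p (v := fun z => v (p, z)) (by fun_prop) fun z hz => hC (p, z) hz)

theorem integrable_totalReward_and_cumulativeReward_eq_sum (σ : Strategy 𝒳 𝒜 𝒪) [∀ t, IsMarkovKernel (σ t)] (T : ℕ) :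
    Integrable totalReward (Φ.law σ T) ∧ Φ.cumulativeReward T σ =
      ∑ t ∈ Finset.range T, ∫ p, ∫ x, ∫ a, Φ.meanReward (x, a, p.1) ∂σ t (p, x) ∂Φ.context
        ∂Φ.law σ t := by
  induction T with
  | zero =>
    have : (totalReward : 𝒪 × History 𝒳 𝒜 0 → ℝ) = fun _ => 0 := by ext; simp [totalReward]
    simp [cumulativeReward, this]
  | succ T ih =>
    rw [Finset.sum_range_succ, ← ih.2]
    refine hL.integral_extend (Φ.law σ T) (σ T) (by unfold totalReward; fun_prop) ih.1
      (v := fun q => q.2.2) (C := L) (by fun_prop) (fun q hq => ?_) fun q => ?_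
    · exact abs_le.2 ⟨by linarith [hq.1, hq.2], hq.2⟩
    · simp [totalReward, append, Fin.sum_univ_castSucc]

theorem cumulativeReward_eq_sum (σ : Strategy 𝒳 𝒜 𝒪) [∀ t, IsMarkovKernel (σ t)] (T : ℕ) :
    Φ.cumulativeReward T σ =
      ∑ t ∈ Finset.range T, ∫ p, ∫ x, ∫ a, Φ.meanReward (x, a, p.1) ∂σ t (p, x) ∂Φ.context
        ∂Φ.law σ t :=
  (hL.integrable_totalReward_and_cumulativeReward_eq_sum σ T).2

end RewardBounded

theorem map_fst_law (σ : Strategy 𝒳 𝒜 𝒪) [∀ t, IsMarkovKernel (σ t)] (t : ℕ) :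
    (Φ.law σ t).map Prod.fst = Φ.prior := by
  induction t with
  | zero =>
    rw [law, initial, Measure.map_map (by fun_prop) (by fun_prop)]
    exact Measure.map_id
  | succ t ih =>
    have h : (Prod.fst ∘ append : (𝒪 × History 𝒳 𝒜 t) × ((𝒳 × 𝒜) × ℝ) → 𝒪) =
      Prod.fst ∘ Prod.fst := rfl
    rw [law, extend, Measure.map_map (by fun_prop) measurable_append, h,
      ← Measure.map_map (by fun_prop) (by fun_prop), ← ih]
    congr 1
    exact Measure.fst_compProd _ _

theorem integral_law_fst (σ : Strategy 𝒳 𝒜 𝒪) [∀ t, IsMarkovKernel (σ t)] (t : ℕ) {g : 𝒪 → ℝ}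
    (hg : Measurable g) : ∫ p, g p.1 ∂Φ.law σ t = ∫ θ, g θ ∂Φ.prior := by
  rw [← Φ.map_fst_law σ t, integral_map (by fun_prop) hg.aestronglyMeasurable]

theorem lintegral_round_blind (φ : Policy 𝒳 𝒜) [∀ t, IsMarkovKernel (φ t)] {t : ℕ}
    (p : 𝒪 × History 𝒳 𝒜 t) {f : (𝒳 × 𝒜) × ℝ → ENNReal}
    (hf : Measurable f) :
    ∫⁻ z, f z ∂Φ.round (φ.blind 𝒪 t) p =
      ∫⁻ x, ∫⁻ a, ∫⁻ r, f ((x, a), r) ∂Φ.reward (x, a, p.1) ∂φ t (p.2, x) ∂Φ.context := by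
  rw [round, Kernel.lintegral_compProd _ _ _ hf, Kernel.lintegral_compProd]
  · rfl
  · exact Measurable.lintegral_kernel_prod_right'' hf

/-- The oracle's expected reward in a round depends on the parameter alone, whose law is the prior
under every strategy. It can thus be computed under the law of any `σ`, in particular that of
Thompson Sampling. -/
theorem RewardBounded.cumulativeReward_oracle {Φ : ContextualBandit 𝒳 𝒜 𝒪}
    (hL : Φ.RewardBounded L) [MeasurableSingletonClass 𝒜]
    {ψ : 𝒳 × 𝒪 → 𝒜} (hψ : Measurable ψ) (σ : Strategy 𝒳 𝒜 𝒪) [∀ t, IsMarkovKernel (σ t)] (T : ℕ) :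
    Φ.cumulativeReward T (oracle ψ hψ) =
      ∑ t ∈ Finset.range T, ∫ p, ∫ x, Φ.meanReward (x, ψ (x, p.1), p.1) ∂Φ.context ∂Φ.law σ t := by
  have hg : Measurable fun θ => ∫ x, Φ.meanReward (x, ψ (x, θ), θ) ∂Φ.context :=
    Measurable.integral_kernel_prod_right (κ := Kernel.const 𝒪 Φ.context)
      (f := fun q : 𝒪 × 𝒳 => Φ.meanReward (q.2, ψ (q.2, q.1), q.1)) (by fun_prop)
  rw [hL.cumulativeReward_eq_sum]
  refine Finset.sum_congr rfl fun t _ => ?_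
  rw [Φ.integral_law_fst σ t hg, ← Φ.integral_law_fst (oracle ψ hψ) t hg]
  simp [oracle, Kernel.deterministic_apply]

theorem IsOptimal.optimalReward_eq {T : ℕ} {ψ : 𝒳 × 𝒪 → 𝒜} (hψ : Φ.IsOptimal T ψ) :
    Φ.optimalReward T = Φ.cumulativeReward T (oracle ψ hψ.measurable) := by
  have : Nonempty {ψ : 𝒳 × 𝒪 → 𝒜 // Φ.IsAdmissible T ψ} := ⟨⟨ψ, hψ.toIsAdmissible⟩⟩
  refine le_antisymm (ciSup_le fun χ => hψ.le χ.1 χ.2) ?_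
  exact le_ciSup (f := fun χ : {ψ : 𝒳 × 𝒪 → 𝒜 // Φ.IsAdmissible T ψ} =>
    Φ.cumulativeReward T (oracle χ.1 χ.2.measurable))
    ⟨_, Set.forall_mem_range.2 fun χ => hψ.le χ.1 χ.2⟩ ⟨ψ, hψ.toIsAdmissible⟩

end ContextualBandit

namespace ContextualBandit

variable {𝒳 𝒜 𝒪 : Type*} [MeasurableSpace 𝒳] [MeasurableSpace 𝒜] [MeasurableSpace 𝒪]
  [StandardBorelSpace 𝒪] [Nonempty 𝒪]

/-! ### Disintegration along the posterior. -/

section Posterior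

variable {t : ℕ} (ρ : Measure (𝒪 × History 𝒳 𝒜 t)) [IsProbabilityMeasure ρ]

theorem lintegral_posterior {f : 𝒪 × History 𝒳 𝒜 t → ENNReal} (hf : Measurable f) :
    ∫⁻ p, f p ∂ρ = ∫⁻ p, ∫⁻ θ, f (θ, p.2) ∂posterior ρ p.2 ∂ρ := by
  have hf' : Measurable fun q : History 𝒳 𝒜 t × 𝒪 => f q.swap := hf.comp measurable_swap
  have : ∫⁻ p, f p ∂ρ = ∫⁻ q, f q.swap ∂ρ.map Prod.swap := by
    rw [lintegral_map hf' measurable_swap]; simp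
  rw [this, ← Measure.lintegral_condKernel hf', Measure.fst,
    Measure.map_map measurable_fst measurable_swap, lintegral_map _ (by fun_prop)]
  · rfl
  · exact Measurable.lintegral_kernel_prod_right' hf'

theorem integral_posterior {f : 𝒪 × History 𝒳 𝒜 t → ℝ} (hf : Measurable f)
    (hi : Integrable f ρ) :
    ∫ p, f p ∂ρ = ∫ p, ∫ θ, f (θ, p.2) ∂posterior ρ p.2 ∂ρ := by
  have hf' : Measurable fun q : History 𝒳 𝒜 t × 𝒪 => f q.swap := hf.comp measurable_swap
  have h1 : Integrable (fun q : History 𝒳 𝒜 t × 𝒪 => f q.swap) (ρ.map Prod.swap) := by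
    rw [integrable_map_measure hf'.aestronglyMeasurable measurable_swap.aemeasurable]
    exact hi
  have : ∫ p, f p ∂ρ = ∫ q, f q.swap ∂ρ.map Prod.swap := by
    rw [integral_map measurable_swap.aemeasurable hf'.aestronglyMeasurable]; simp
  rw [this, ← Measure.integral_condKernel h1, Measure.fst,
    Measure.map_map measurable_fst measurable_swap, integral_map (by fun_prop)]
  · rfl
  · exact (Measurable.integral_kernel_prod_right hf').aestronglyMeasurable

/-- Given the history, the context is independent of the parameter. -/
theorem integral_integral_posterior (c : Measure 𝒳) [IsProbabilityMeasure c]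
    {G : 𝒪 → History 𝒳 𝒜 t → 𝒳 → ℝ}
    (hG : Measurable fun q : 𝒪 × History 𝒳 𝒜 t × 𝒳 => G q.1 q.2.1 q.2.2) {C : ℝ}
    (hC : ∀ θ h x, |G θ h x| ≤ C) :
    ∫ p, ∫ x, G p.1 p.2 x ∂c ∂ρ = ∫ p, ∫ x, ∫ θ, G θ p.2 x ∂posterior ρ p.2 ∂c ∂ρ := by
  have hm : Measurable fun p : 𝒪 × History 𝒳 𝒜 t => ∫ x, G p.1 p.2 x ∂c :=
    Measurable.integral_kernel_prod_right (κ := Kernel.const _ c)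
      (f := fun q : (𝒪 × History 𝒳 𝒜 t) × 𝒳 => G q.1.1 q.1.2 q.2)
      (hG.comp (f := fun q : (𝒪 × History 𝒳 𝒜 t) × 𝒳 => (q.1.1, q.1.2, q.2)) (by fun_prop))
  rw [integral_posterior ρ hm (.of_bound hm.aestronglyMeasurable C
    (ae_of_all _ fun p => abs_integral_le_of_ae (ae_of_all _ fun x => hC _ _ _)))]
  refine integral_congr_ae (ae_of_all _ fun p => integral_integral_swap
    (.of_bound (Measurable.aestronglyMeasurable ?_) C (ae_of_all _ fun q => hC _ _ _)))
  exact hG.comp (f := fun q : 𝒪 × 𝒳 => (q.1, p.2, q.2)) (by fun_prop)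

end Posterior

variable (Φ : ContextualBandit 𝒳 𝒜 𝒪) {L : ℝ}

/-! ### Gaps, tilts and Hoeffding's lemma. -/

section Gap

variable {t : ℕ} (ρ : Measure (𝒪 × History 𝒳 𝒜 t)) [IsProbabilityMeasure ρ]

/-- The mean reward of an action in a context, under the posterior given the history. -/
noncomputable def posteriorMean (h : History 𝒳 𝒜 t) (y : 𝒳 × 𝒜) : ℝ :=
  ∫ θ, Φ.meanReward (y.1, y.2, θ) ∂posterior ρ h

/-- How far the mean reward under a parameter is from the posterior mean reward. -/
noncomputable def gap (θ : 𝒪) (h : History 𝒳 𝒜 t) (y : 𝒳 × 𝒜) : ℝ :=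
  Φ.meanReward (y.1, y.2, θ) - Φ.posteriorMean ρ h y

/-- The exponent of the exponential tilt towards `θ` of the posterior law of the reward, optimised
for Hoeffding's lemma with rewards in `[0, L]`. -/
noncomputable def tilt (L : ℝ) (θ : 𝒪) (h : History 𝒳 𝒜 t) (z : (𝒳 × 𝒜) × ℝ) : ℝ :=
  4 * Φ.gap ρ θ h z.1 / L ^ 2 * (z.2 - Φ.posteriorMean ρ h z.1) - 2 * Φ.gap ρ θ h z.1 ^ 2 / L ^ 2

theorem measurable_posteriorMean :
    Measurable fun q : History 𝒳 𝒜 t × 𝒳 × 𝒜 => Φ.posteriorMean ρ q.1 q.2 :=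
  Measurable.integral_kernel_prod_right (κ := (posterior ρ).prodMkRight (𝒳 × 𝒜))
    (f := fun q => Φ.meanReward (q.1.2.1, q.1.2.2, q.2)) (by fun_prop)

theorem measurable_gap :
    Measurable fun q : 𝒪 × History 𝒳 𝒜 t × 𝒳 × 𝒜 => Φ.gap ρ q.1 q.2.1 q.2.2 := by
  have := (Φ.measurable_posteriorMean ρ).comp
    (f := fun q : 𝒪 × History 𝒳 𝒜 t × 𝒳 × 𝒜 => q.2) (by fun_prop)
  exact Measurable.sub (by fun_prop) this

theorem measurable_tilt (L : ℝ) :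
    Measurable fun q : 𝒪 × History 𝒳 𝒜 t × (𝒳 × 𝒜) × ℝ => Φ.tilt ρ L q.1 q.2.1 q.2.2 := by
  have h1 := (Φ.measurable_posteriorMean ρ).comp (f := fun q : 𝒪 × History 𝒳 𝒜 t × (𝒳 × 𝒜) × ℝ =>
    (q.2.1, q.2.2.1)) (by fun_prop)
  have h2 := (Φ.measurable_gap ρ).comp (f := fun q : 𝒪 × History 𝒳 𝒜 t × (𝒳 × 𝒜) × ℝ =>
    (q.1, q.2.1, q.2.2.1)) (by fun_prop)
  exact (((measurable_const.mul h2).div_const _).mul (Measurable.sub (by fun_prop) h1)).sub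
    ((measurable_const.mul (h2.pow_const 2)).div_const _)

variable {Φ} (hL : Φ.RewardBounded L)
include hL

theorem RewardBounded.posteriorMean_mem (h : History 𝒳 𝒜 t) (y : 𝒳 × 𝒜) :
    Φ.posteriorMean ρ h y ∈ Set.Icc 0 L := by
  refine ⟨integral_nonneg fun θ => (hL.meanReward_mem _).1, ?_⟩
  refine (le_abs_self _).trans (abs_integral_le_of_ae (ae_of_all _ fun θ => ?_))
  rw [abs_of_nonneg (hL.meanReward_mem _).1]
  exact (hL.meanReward_mem _).2

theorem RewardBounded.abs_gap_le (θ : 𝒪) (h : History 𝒳 𝒜 t) (y : 𝒳 × 𝒜) :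
    |Φ.gap ρ θ h y| ≤ L := by
  have h1 := hL.meanReward_mem (y.1, y.2, θ)
  have h2 := hL.posteriorMean_mem ρ h y
  exact abs_le.2 ⟨by unfold gap; linarith [h1.1, h2.2], by unfold gap; linarith [h1.2, h2.1]⟩

theorem RewardBounded.abs_tilt_le (θ : 𝒪) (h : History 𝒳 𝒜 t) (z : (𝒳 × 𝒜) × ℝ)
    (hz : z.2 ∈ Set.Icc 0 L) :
    |Φ.tilt ρ L θ h z| ≤ 4 * L / L ^ 2 * L + 2 * L ^ 2 / L ^ 2 := by
  have h1 := hL.abs_gap_le ρ θ h z.1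
  have h2 := hL.posteriorMean_mem ρ h z.1
  have h3 : |z.2 - Φ.posteriorMean ρ h z.1| ≤ L :=
    abs_le.2 ⟨by linarith [hz.1, h2.2], by linarith [hz.2, h2.1]⟩
  have h0 : 0 ≤ L := (abs_nonneg _).trans h1
  refine (abs_sub _ _).trans ?_
  simp only [abs_mul, abs_div, abs_pow, Nat.abs_ofNat, sq_abs, abs_of_nonneg h0]
  rw [← sq_abs (Φ.gap ρ θ h z.1)]
  gcongr

/-- Under the law of `θ` itself, the centred reward has mean equal to the gap, so the tilt has mean
`4 * gap ^ 2 / L ^ 2 - 2 * gap ^ 2 / L ^ 2`. -/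
theorem RewardBounded.integral_tilt (θ : 𝒪) (h : History 𝒳 𝒜 t) (y : 𝒳 × 𝒜) :
    ∫ r, Φ.tilt ρ L θ h (y, r) ∂Φ.reward (y.1, y.2, θ) = 2 / L ^ 2 * Φ.gap ρ θ h y ^ 2 := by
  have h1 : Integrable (fun r => r - Φ.posteriorMean ρ h y) (Φ.reward (y.1, y.2, θ)) :=
    (hL.integrable _).sub (integrable_const _)
  have h2 : ∫ r, (r - Φ.posteriorMean ρ h y) ∂Φ.reward (y.1, y.2, θ) = Φ.gap ρ θ h y := by
    rw [integral_sub (hL.integrable _) (integrable_const _)]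
    simp [gap, meanReward]
  simp only [tilt]
  rw [integral_sub (h1.const_mul _) (integrable_const _), integral_const_mul, h2]
  simp
  ring

/-- Hoeffding's lemma for the posterior law of the reward. -/
theorem RewardBounded.lintegral_exp_tilt_le_one (θ₀ : 𝒪) (h : History 𝒳 𝒜 t) (y : 𝒳 × 𝒜) :
    ∫⁻ θ, ∫⁻ r, ENNReal.ofReal (Real.exp (Φ.tilt ρ L θ₀ h (y, r))) ∂Φ.reward (y.1, y.2, θ)
      ∂posterior ρ h ≤ 1 := by
  -- `μ` is the predictive law of the reward: supported in `[0, L]`, with mean `posteriorMean`.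
  let κ : Kernel 𝒪 ℝ := Φ.reward.comap (fun θ => (y.1, y.2, θ)) (by fun_prop)
  let μ : Measure ℝ := (κ ∘ₖ posterior ρ) h
  have hμ : ∀ᵐ r ∂μ, r ∈ Set.Icc 0 L :=
    Kernel.ae_comp_of_ae_ae measurableSet_Icc (ae_of_all _ fun θ => hL _)
  have hmean : ∫ r, r ∂μ = Φ.posteriorMean ρ h y :=
    Kernel.integral_comp (Integrable.of_mem_Icc 0 L aemeasurable_id hμ)
  have hsub := hasSubgaussianMGF_of_mem_Icc (X := fun r : ℝ => r) aemeasurable_id hμ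
  rw [hmean] at hsub
  have hm : Measurable fun r => ENNReal.ofReal (Real.exp (Φ.tilt ρ L θ₀ h (y, r))) :=
    ((Φ.measurable_tilt ρ L).comp (f := fun r => (θ₀, h, y, r)) (by fun_prop)).exp.ennreal_ofReal
  set g := Φ.gap ρ θ₀ h y with hg
  have hexp : ∀ r, Real.exp (Φ.tilt ρ L θ₀ h (y, r)) =
      Real.exp (4 * g / L ^ 2 * (r - Φ.posteriorMean ρ h y)) * Real.exp (-(2 * g ^ 2 / L ^ 2)) :=
    fun r => by rw [← Real.exp_add, ← sub_eq_add_neg]; rfl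
  have hint : Integrable (fun r => Real.exp (Φ.tilt ρ L θ₀ h (y, r))) μ := by
    simp_rw [hexp]
    exact (hsub.integrable_exp_mul _).mul_const _
  calc _ = ∫⁻ r, ENNReal.ofReal (Real.exp (Φ.tilt ρ L θ₀ h (y, r))) ∂μ :=
        (Kernel.lintegral_comp κ (posterior ρ) h hm).symm
    _ = ENNReal.ofReal (∫ r, Real.exp (Φ.tilt ρ L θ₀ h (y, r)) ∂μ) :=
        (ofReal_integral_eq_lintegral_ofReal hint (ae_of_all _ fun r => (Real.exp_pos _).le)).symm
    _ ≤ 1 := by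
      rw [ENNReal.ofReal_le_one]
      simp_rw [hexp]
      rw [integral_mul_const]
      have := hsub.mgf_le (4 * g / L ^ 2)
      rw [mgf] at this
      refine (mul_le_mul_of_nonneg_right this (Real.exp_pos _).le).trans ?_
      rw [← Real.exp_add, Real.exp_le_one_iff]
      rcases eq_or_ne L 0 with rfl | h0
      · simp
      -- The variance proxy is `L ^ 2 / 4`; at slope `4 * g / L ^ 2` the Hoeffding exponent is
      -- exactly the `2 * g ^ 2 / L ^ 2` subtracted in `tilt`.
      · refine le_of_eq ?_
        simp only [sub_zero, NNReal.coe_pow, NNReal.coe_div, coe_nnnorm, NNReal.coe_ofNat,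
          Real.norm_eq_abs, div_pow, sq_abs]
        field_simp
        ring

end Gap

/-! ### Exponential supermartingales and the information bound. -/

section Score

variable (φ : Policy 𝒳 𝒜) [∀ t, IsMarkovKernel (φ t)]

/-- The sum of the tilts towards `θ` along the history of an interaction with the policy `φ`. -/
noncomputable def score (L : ℝ) (θ : 𝒪) : ∀ t : ℕ, History 𝒳 𝒜 t → ℝ
  | 0, _ => 0
  | t + 1, h => score L θ t (Fin.init h) +
    Φ.tilt (Φ.law (φ.blind 𝒪) t) L θ (Fin.init h) (h (Fin.last t))

theorem score_append (L : ℝ) (θ : 𝒪) {t : ℕ} (q : (𝒪 × History 𝒳 𝒜 t) × ((𝒳 × 𝒜) × ℝ)) :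
    Φ.score φ L θ (t + 1) (append q).2 =
      Φ.score φ L θ t q.1.2 + Φ.tilt (Φ.law (φ.blind 𝒪) t) L θ q.1.2 q.2 := by
  simp [score, append]

theorem measurable_score (L : ℝ) (t : ℕ) :
    Measurable fun p : 𝒪 × History 𝒳 𝒜 t => Φ.score φ L p.1 t p.2 := by
  induction t with
  | zero => exact measurable_const
  | succ t ih =>
    have h0 : Measurable fun h : History 𝒳 𝒜 (t + 1) => (Fin.init h : History 𝒳 𝒜 t) :=
      measurable_pi_iff.2 fun i => measurable_pi_apply _
    refine (ih.comp (f := fun p : 𝒪 × History 𝒳 𝒜 (t + 1) => (p.1, Fin.init p.2)) ?_).add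
      ((Φ.measurable_tilt _ L).comp (f := fun p : 𝒪 × History 𝒳 𝒜 (t + 1) =>
        (p.1, Fin.init p.2, p.2 (Fin.last t))) ?_)
    · fun_prop
    · fun_prop

variable {Φ} (hL : Φ.RewardBounded L)
include hL

/-- Evaluated at the true parameter `p.1`, the score has positive drift: it measures the accumulated
squared gaps. -/
theorem RewardBounded.integral_score (t : ℕ) :
    Integrable (fun p => Φ.score φ L p.1 t p.2) (Φ.law (φ.blind 𝒪) t) ∧
    ∫ p, Φ.score φ L p.1 t p.2 ∂Φ.law (φ.blind 𝒪) t =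
      2 / L ^ 2 * ∑ s ∈ Finset.range t, ∫ p, ∫ x, ∫ a,
        Φ.gap (Φ.law (φ.blind 𝒪) s) p.1 p.2 (x, a) ^ 2 ∂φ s (p.2, x) ∂Φ.context
          ∂Φ.law (φ.blind 𝒪) s := by
  induction t with
  | zero => simp [score]
  | succ t ih =>
    have := hL.integral_extend (Φ.law (φ.blind 𝒪) t) (φ.blind 𝒪 t)
      (Φ.measurable_score φ L (t + 1)) ih.1
      ((Φ.measurable_tilt (Φ.law (φ.blind 𝒪) t) L).comp
        (f := fun q : (𝒪 × History 𝒳 𝒜 t) × ((𝒳 × 𝒜) × ℝ) => (q.1.1, q.1.2, q.2)) (by fun_prop))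
      (fun q hq => hL.abs_tilt_le _ q.1.1 q.1.2 q.2 hq) (fun q => Φ.score_append φ L q.1.1 q)
    refine ⟨this.1, this.2.trans ?_⟩
    rw [ih.2, Finset.sum_range_succ, mul_add, ← integral_const_mul]
    congr 1
    refine integral_congr_ae (ae_of_all _ fun p => ?_)
    simp only [← integral_const_mul]
    refine integral_congr_ae (ae_of_all _ fun x => ?_)
    refine integral_congr_ae (ae_of_all _ fun a => ?_)
    exact hL.integral_tilt _ p.1 p.2 (x, a)

/-- Given the history, context and action do not depend on the parameter, so Tonelli moves the
posterior integral next to the reward and the one-action Hoeffding bound applies. -/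
theorem RewardBounded.lintegral_round_exp_tilt_le_one {t : ℕ}
    (ρ : Measure (𝒪 × History 𝒳 𝒜 t)) [IsProbabilityMeasure ρ] (θ₀ : 𝒪) (h : History 𝒳 𝒜 t) :
    ∫⁻ θ, ∫⁻ z, ENNReal.ofReal (Real.exp (Φ.tilt ρ L θ₀ h z)) ∂Φ.round (φ.blind 𝒪 t) (θ, h)
      ∂posterior ρ h ≤ 1 := by
  set k : (𝒳 × 𝒜) × ℝ → ENNReal := fun z => ENNReal.ofReal (Real.exp (Φ.tilt ρ L θ₀ h z)) with hkd
  have hk : Measurable k := ((Φ.measurable_tilt ρ L).comp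
    (f := fun z : (𝒳 × 𝒜) × ℝ => (θ₀, h, z)) (by fun_prop)).exp.ennreal_ofReal
  have h1 : Measurable fun q : (𝒪 × 𝒳 × 𝒜) =>
      ∫⁻ r, k (q.2, r) ∂Φ.reward (q.2.1, q.2.2, q.1) :=
    Measurable.lintegral_kernel_prod_right'
      (κ := Φ.reward.comap (fun q : 𝒪 × 𝒳 × 𝒜 => (q.2.1, q.2.2, q.1)) (by fun_prop))
      (f := fun q => k (q.1.2, q.2)) (by fun_prop)
  simp_rw [Φ.lintegral_round_blind φ _ hk]
  rw [lintegral_lintegral_swap]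
  · calc _ ≤ ∫⁻ x, 1 ∂Φ.context := by
          refine lintegral_mono fun x => ?_
          rw [lintegral_lintegral_swap]
          · calc _ ≤ ∫⁻ a, 1 ∂φ t (h, x) :=
                  lintegral_mono fun a => hL.lintegral_exp_tilt_le_one ρ θ₀ h (x, a)
              _ = 1 := by simp
          · exact (h1.comp (f := fun q : 𝒪 × 𝒜 => (q.1, x, q.2)) (by fun_prop)).aemeasurable
      _ = 1 := by simp
  · exact (Measurable.lintegral_kernel_prod_right'
      (κ := (φ t).comap (fun q : 𝒪 × 𝒳 => (h, q.2)) (by fun_prop))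
      (f := fun q => ∫⁻ r, k ((q.1.2, q.2), r) ∂Φ.reward (q.1.2, q.2, q.1.1))
      (h1.comp (f := fun q : (𝒪 × 𝒳) × 𝒜 => (q.1.1, q.1.2, q.2))
        (by fun_prop))).aemeasurable

/-- Supermartingale property for a fixed `θ₀`. The integrand sees only the history, so the parameter
generating the rewards can be resampled from the posterior, after which the new factor averages to
at most `1`. -/
theorem RewardBounded.lintegral_exp_score_le_one (θ₀ : 𝒪) (t : ℕ) :
    ∫⁻ p, ENNReal.ofReal (Real.exp (Φ.score φ L θ₀ t p.2)) ∂Φ.law (φ.blind 𝒪) t ≤ 1 := by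
  induction t with
  | zero => simp [score]
  | succ t ih =>
    have hm : Measurable fun p : 𝒪 × History 𝒳 𝒜 (t + 1) =>
        ENNReal.ofReal (Real.exp (Φ.score φ L θ₀ (t + 1) p.2)) :=
      ((Φ.measurable_score φ L (t + 1)).comp
        (f := fun p : 𝒪 × History 𝒳 𝒜 (t + 1) => (θ₀, p.2)) (by fun_prop)).exp.ennreal_ofReal
    set ρ := Φ.law (φ.blind 𝒪) t with hρ
    set g : History 𝒳 𝒜 t → ENNReal :=
      fun h => ENNReal.ofReal (Real.exp (Φ.score φ L θ₀ t h)) with hgd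
    set k : History 𝒳 𝒜 t × (𝒳 × 𝒜) × ℝ → ENNReal :=
      fun q => ENNReal.ofReal (Real.exp (Φ.tilt ρ L θ₀ q.1 q.2)) with hkd
    have hg : Measurable g := ((Φ.measurable_score φ L t).comp
      (f := fun h : History 𝒳 𝒜 t => (θ₀, h)) (by fun_prop)).exp.ennreal_ofReal
    have hk : Measurable k := ((Φ.measurable_tilt ρ L).comp
      (f := fun q : History 𝒳 𝒜 t × (𝒳 × 𝒜) × ℝ => (θ₀, q)) (by fun_prop)).exp.ennreal_ofReal
    have hK : Measurable fun p : 𝒪 × History 𝒳 𝒜 t =>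
        ∫⁻ z, k (p.2, z) ∂Φ.round (φ.blind 𝒪 t) p :=
      Measurable.lintegral_kernel_prod_right' (κ := Φ.round (φ.blind 𝒪 t))
        (f := fun q => k (q.1.2, q.2)) (by fun_prop)
    have hsucc (q : (𝒪 × History 𝒳 𝒜 t) × ((𝒳 × 𝒜) × ℝ)) :
        ENNReal.ofReal (Real.exp (Φ.score φ L θ₀ (t + 1) (append q).2)) =
          g q.1.2 * k (q.1.2, q.2) := by
      rw [score_append, Real.exp_add, ENNReal.ofReal_mul (Real.exp_pos _).le]
    rw [law, ← hρ, extend, lintegral_map hm measurable_append]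
    simp_rw [hsucc]
    rw [Measure.lintegral_compProd (by fun_prop)]
    calc _ = ∫⁻ p, g p.2 * ∫⁻ z, k (p.2, z) ∂Φ.round (φ.blind 𝒪 t) p ∂ρ :=
          lintegral_congr fun p => lintegral_const_mul _ (by fun_prop)
      _ = ∫⁻ p, ∫⁻ θ, g p.2 * ∫⁻ z, k (p.2, z) ∂Φ.round (φ.blind 𝒪 t) (θ, p.2)
            ∂posterior ρ p.2 ∂ρ :=
          lintegral_posterior ρ ((hg.comp measurable_snd).mul hK)
      _ = ∫⁻ p, g p.2 * ∫⁻ θ, ∫⁻ z, k (p.2, z) ∂Φ.round (φ.blind 𝒪 t) (θ, p.2)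
            ∂posterior ρ p.2 ∂ρ :=
          lintegral_congr fun p => lintegral_const_mul _
            (hK.comp (f := fun θ => (θ, p.2)) (by fun_prop))
      _ ≤ ∫⁻ p, g p.2 * 1 ∂ρ :=
          lintegral_mono fun p => mul_le_mul_right (hL.lintegral_round_exp_tilt_le_one φ ρ θ₀ p.2) _
      _ ≤ 1 := by simpa using ih

/-- The information about a finite parameter that any policy collects is at most `log |𝒪|`. -/
theorem RewardBounded.sum_integral_gap_sq_le [Fintype 𝒪] (T : ℕ) :
    ∑ t ∈ Finset.range T, ∫ p, ∫ x, ∫ a,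
        Φ.gap (Φ.law (φ.blind 𝒪) t) p.1 p.2 (x, a) ^ 2 ∂φ t (p.2, x) ∂Φ.context
          ∂Φ.law (φ.blind 𝒪) t ≤ L ^ 2 * Real.log (Fintype.card 𝒪) / 2 := by
  have hN : (0 : ℝ) < Fintype.card 𝒪 := by exact_mod_cast Fintype.card_pos
  -- For `L = 0` the factor `2 / L ^ 2` is `0` and the score carries no information, but all gaps
  -- vanish.
  rcases eq_or_ne L 0 with rfl | h0
  · have : ∀ t θ (h : History 𝒳 𝒜 t) y, Φ.gap (Φ.law (φ.blind 𝒪) t) θ h y = 0 :=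
      fun t θ h y => abs_nonpos_iff.1 (hL.abs_gap_le _ θ h y)
    simp [this]
  set ρ := Φ.law (φ.blind 𝒪) T
  have hmeas (θ : 𝒪) : Measurable fun p : 𝒪 × History 𝒳 𝒜 T => Real.exp (Φ.score φ L θ T p.2) :=
    ((Φ.measurable_score φ L T).comp (f := fun p : 𝒪 × History 𝒳 𝒜 T => (θ, p.2)) (by fun_prop)).exp
  have hint (θ : 𝒪) : Integrable (fun p => Real.exp (Φ.score φ L θ T p.2)) ρ := by
    refine ⟨(hmeas θ).aestronglyMeasurable, ?_⟩
    rw [hasFiniteIntegral_iff_ofReal (ae_of_all _ fun p => (Real.exp_pos _).le)]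
    exact (hL.lintegral_exp_score_le_one φ θ T).trans_lt ENNReal.one_lt_top
  have hle (θ : 𝒪) : ∫ p, Real.exp (Φ.score φ L θ T p.2) ∂ρ ≤ 1 := by
    rw [integral_eq_lintegral_of_nonneg_ae (ae_of_all _ fun p => (Real.exp_pos _).le)
      (hmeas θ).aestronglyMeasurable]
    exact ENNReal.toReal_le_of_le_ofReal zero_le_one
      (by simpa using hL.lintegral_exp_score_le_one φ θ T)
  obtain ⟨hi, hs⟩ := hL.integral_score φ T
  have key : ∫ p, Φ.score φ L p.1 T p.2 ∂ρ ≤ Real.log (Fintype.card 𝒪) := by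
    calc _ ≤ ∫ p, ((∑ θ, Real.exp (Φ.score φ L θ T p.2)) / Fintype.card 𝒪
          + (Real.log (Fintype.card 𝒪) - 1)) ∂ρ :=
          integral_mono hi (((integrable_finsetSum _ fun θ _ => hint θ).div_const _).add
            (integrable_const _)) fun p => by
              have := le_sum_exp_div_card_add_log_card (fun θ => Φ.score φ L θ T p.2) p.1
              dsimp only at this ⊢
              linarith
      _ = (∑ θ, ∫ p, Real.exp (Φ.score φ L θ T p.2) ∂ρ) / Fintype.card 𝒪
          + (Real.log (Fintype.card 𝒪) - 1) := by
          rw [integral_add ((integrable_finsetSum _ fun θ _ => hint θ).div_const _)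
            (integrable_const _), integral_div, integral_finsetSum _ fun θ _ => hint θ]
          simp
      _ ≤ 1 + (Real.log (Fintype.card 𝒪) - 1) := by
          gcongr
          rw [div_le_one hN]
          exact (Finset.sum_le_sum fun θ _ => hle θ).trans (by simp)
      _ = _ := by ring
  rw [hs] at key
  have hL2 : 0 < L ^ 2 := by positivity
  rw [div_mul_eq_mul_div, div_le_iff₀ hL2] at key
  linarith

end Score

end ContextualBandit

/-! ### Regret of one round and summation over the rounds. -/

namespace ContextualBandit

variable {𝒳 𝒜 𝒪 : Type*} [MeasurableSpace 𝒳] [MeasurableSpace 𝒜] [MeasurableSpace 𝒪]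
  [StandardBorelSpace 𝒪] [Nonempty 𝒪] {Φ : ContextualBandit 𝒳 𝒜 𝒪} {L : ℝ}

section Linear

variable [Fintype 𝒪] {E : Type*} [NormedAddCommGroup E] [InnerProductSpace ℝ E]
  [FiniteDimensional ℝ E] {v : 𝒪 → E} {m : 𝒳 × 𝒜 → E}

theorem sq_integral_regret_le
    (hm : ∀ x a θ, Φ.meanReward (x, a, θ) = inner ℝ (v θ) (m (x, a)))
    {t : ℕ} (ρ : Measure (𝒪 × History 𝒳 𝒜 t)) [IsProbabilityMeasure ρ] (h : History 𝒳 𝒜 t)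
    (x : 𝒳) (α : 𝒪 → 𝒜) :
    (∫ θ, (Φ.meanReward (x, α θ, θ) - ∫ θ', Φ.meanReward (x, α θ', θ) ∂posterior ρ h)
        ∂posterior ρ h) ^ 2 ≤
      Module.finrank ℝ E *
        ∫ θ, ∫ θ', Φ.gap ρ θ h (x, α θ') ^ 2 ∂posterior ρ h ∂posterior ρ h := by
  set p : 𝒪 → ℝ := fun θ => (posterior ρ h).real {θ} with hp
  have hfin (f : 𝒪 → ℝ) : ∫ θ, f θ ∂posterior ρ h = ∑ θ, p θ * f θ :=
    integral_fintype .of_finite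
  have hgap (θ : 𝒪) (a : 𝒜) : Φ.gap ρ θ h (x, a) =
      inner ℝ (v θ - ∑ θ', p θ' • v θ') (m (x, a)) := by
    simp [gap, posteriorMean, hfin, hm, inner_sub_left, sum_inner, inner_smul_left]
  -- Probability matching: `θ` and `θ'` have the same law, so averaging the sampled action's reward
  -- over `θ` gives the posterior mean at `α θ'`, and renaming `θ'` to `θ` leaves the diagonal gaps.
  have hreg : ∫ θ, (Φ.meanReward (x, α θ, θ) - ∫ θ', Φ.meanReward (x, α θ', θ) ∂posterior ρ h)
        ∂posterior ρ h = ∑ θ, p θ * Φ.gap ρ θ h (x, α θ) := by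
    simp_rw [gap, posteriorMean, hfin, mul_sub, Finset.sum_sub_distrib, Finset.mul_sum]
    congr 1
    rw [Finset.sum_comm]
    exact Finset.sum_congr rfl fun i _ => Finset.sum_congr rfl fun j _ => by ring
  rw [hreg]
  simp_rw [hfin, hgap, Finset.mul_sum, ← mul_assoc]
  have := sq_sum_inner_le_finrank_mul p (fun θ => measureReal_nonneg)
    (fun θ => v θ - ∑ θ', p θ' • v θ') (fun θ => m (x, α θ))
  simpa only [Finset.mul_sum, ← mul_assoc] using this

/-- The linearised form of the squared bound: it can be integrated over history and context
directly, without Jensen's inequality. -/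
theorem integral_regret_le
    (hm : ∀ x a θ, Φ.meanReward (x, a, θ) = inner ℝ (v θ) (m (x, a)))
    {t : ℕ} (ρ : Measure (𝒪 × History 𝒳 𝒜 t)) [IsProbabilityMeasure ρ] (h : History 𝒳 𝒜 t)
    (x : 𝒳) (α : 𝒪 → 𝒜) {η : ℝ} (hη : 0 < η) :
    ∫ θ, (Φ.meanReward (x, α θ, θ) - ∫ θ', Φ.meanReward (x, α θ', θ) ∂posterior ρ h
        - η / 2 * Module.finrank ℝ E * ∫ θ', Φ.gap ρ θ h (x, α θ') ^ 2 ∂posterior ρ h)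
        ∂posterior ρ h ≤ 1 / (2 * η) := by
  have hsq := sq_integral_regret_le hm ρ h x α
  rw [integral_sub .of_finite .of_finite, integral_const_mul]
  set y := ∫ θ, (Φ.meanReward (x, α θ, θ) - ∫ θ', Φ.meanReward (x, α θ', θ) ∂posterior ρ h)
        ∂posterior ρ h
  have h1 : y ≤ 1 / (2 * η) + η / 2 * y ^ 2 := by
    have h2 : 1 / (2 * η) + η / 2 * y ^ 2 - y = (η * y - 1) ^ 2 / (2 * η) := by
      field_simp; ring
    have : 0 ≤ (η * y - 1) ^ 2 / (2 * η) := by positivity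
    linarith
  have h2 := mul_le_mul_of_nonneg_left hsq (by positivity : 0 ≤ η / 2)
  rw [mul_assoc]
  linarith

end Linear

theorem integral_thompson {ψ : 𝒳 × 𝒪 → 𝒜} (hψ : Measurable ψ) (t : ℕ) (h : History 𝒳 𝒜 t)
    (x : 𝒳) {f : 𝒜 → ℝ} (hf : Measurable f) :
    ∫ a, f a ∂Φ.thompson ψ hψ t (h, x) =
      ∫ θ, f (ψ (x, θ)) ∂posterior (Φ.law ((Φ.thompson ψ hψ).blind 𝒪) t) h := by
  rw [thompson_apply, integral_map (by fun_prop) hf.aestronglyMeasurable]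

variable [Fintype 𝒪] {E : Type*} [NormedAddCommGroup E] [InnerProductSpace ℝ E]
  [FiniteDimensional ℝ E] {v : 𝒪 → E} {m : 𝒳 × 𝒜 → E} (hL : Φ.RewardBounded L)
include hL

theorem RewardBounded.round_regret_le
    (hm : ∀ x a θ, Φ.meanReward (x, a, θ) = inner ℝ (v θ) (m (x, a)))
    {ψ : 𝒳 × 𝒪 → 𝒜} (hψ : Measurable ψ) (t : ℕ) {η : ℝ} (hη : 0 < η)
    {ρ : Measure (𝒪 × History 𝒳 𝒜 t)} (hρ : ρ = Φ.law ((Φ.thompson ψ hψ).blind 𝒪) t)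
    [IsProbabilityMeasure ρ] :
    ∫ p, ∫ x, Φ.meanReward (x, ψ (x, p.1), p.1) ∂Φ.context ∂ρ
      - ∫ p, ∫ x, ∫ a, Φ.meanReward (x, a, p.1) ∂Φ.thompson ψ hψ t (p.2, x) ∂Φ.context ∂ρ
      ≤ 1 / (2 * η) + η / 2 * Module.finrank ℝ E *
        ∫ p, ∫ x, ∫ a, Φ.gap ρ p.1 p.2 (x, a) ^ 2 ∂Φ.thompson ψ hψ t (p.2, x) ∂Φ.context ∂ρ := by
  -- `A` is the oracle's reward, `B` the reward of Thompson Sampling and `D` its squared gap, the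
  -- last two averaged over the sampled parameter.
  let A : 𝒪 × History 𝒳 𝒜 t × 𝒳 → ℝ := fun q => Φ.meanReward (q.2.2, ψ (q.2.2, q.1), q.1)
  let B : 𝒪 × History 𝒳 𝒜 t × 𝒳 → ℝ := fun q =>
    ∫ θ, Φ.meanReward (q.2.2, ψ (q.2.2, θ), q.1) ∂posterior ρ q.2.1
  let D : 𝒪 × History 𝒳 𝒜 t × 𝒳 → ℝ := fun q =>
    ∫ θ, Φ.gap ρ q.1 q.2.1 (q.2.2, ψ (q.2.2, θ)) ^ 2 ∂posterior ρ q.2.1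
  let κ : Kernel (𝒪 × History 𝒳 𝒜 t × 𝒳) 𝒪 := (posterior ρ).comap (fun q => q.2.1) (by fun_prop)
  have hA : Measurable A := by fun_prop
  have hB : Measurable B := Measurable.integral_kernel_prod_right (κ := κ)
    (f := fun q => Φ.meanReward (q.1.2.2, ψ (q.1.2.2, q.2), q.1.1)) (by fun_prop)
  have hD : Measurable D := Measurable.integral_kernel_prod_right (κ := κ)
    (f := fun q => Φ.gap ρ q.1.1 q.1.2.1 (q.1.2.2, ψ (q.1.2.2, q.2)) ^ 2)
    (((Φ.measurable_gap ρ).comp (f := fun q : (𝒪 × History 𝒳 𝒜 t × 𝒳) × 𝒪 =>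
      (q.1.1, q.1.2.1, q.1.2.2, ψ (q.1.2.2, q.2))) (by fun_prop)).pow_const 2)
  have hmean (y) : |Φ.meanReward y| ≤ L := by
    rw [abs_of_nonneg (hL.meanReward_mem y).1]; exact (hL.meanReward_mem y).2
  have hA' (q) : |A q| ≤ L := hmean _
  have hB' (q) : |B q| ≤ L := abs_integral_le_of_ae (ae_of_all _ fun θ => hmean _)
  have hD' (q) : |D q| ≤ L ^ 2 := abs_integral_le_of_ae (ae_of_all _ fun θ => by
    rw [abs_pow]; exact pow_le_pow_left₀ (abs_nonneg _) (hL.abs_gap_le ρ _ _ _) 2)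
  set c := η / 2 * Module.finrank ℝ E with hc
  have hc0 : 0 ≤ c := by positivity
  have hAi (q) : |A q - B q - c * D q| ≤ L + L + c * L ^ 2 := by
    refine (abs_sub _ _).trans (add_le_add ((abs_sub _ _).trans (add_le_add (hA' q) (hB' q))) ?_)
    rw [abs_mul, abs_of_nonneg hc0]
    exact mul_le_mul_of_nonneg_left (hD' q) hc0
  have hprod {F : 𝒪 × History 𝒳 𝒜 t × 𝒳 → ℝ} (hF : Measurable F) {C : ℝ} (hC : ∀ q, |F q| ≤ C) :
      Integrable (fun q : (𝒪 × History 𝒳 𝒜 t) × 𝒳 => F (q.1.1, q.1.2, q.2))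
        (ρ.prod Φ.context) :=
    .of_bound (hF.comp (f := fun q : (𝒪 × History 𝒳 𝒜 t) × 𝒳 => (q.1.1, q.1.2, q.2))
      (by fun_prop)).aestronglyMeasurable C (ae_of_all _ fun q => hC _)
  have hiA := hprod hA hA'
  have hiB := hprod hB hB'
  have hiD := hprod hD hD'
  have hplay (f : 𝒪 × History 𝒳 𝒜 t → 𝒳 → 𝒜 → ℝ) (hf : ∀ p x, Measurable (f p x)) :
      ∫ p, ∫ x, ∫ a, f p x a ∂Φ.thompson ψ hψ t (p.2, x) ∂Φ.context ∂ρ =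
        ∫ p, ∫ x, ∫ θ, f p x (ψ (x, θ)) ∂posterior ρ p.2 ∂Φ.context ∂ρ := by
    subst hρ
    exact integral_congr_ae (ae_of_all _ fun p => integral_congr_ae (ae_of_all _ fun x =>
      integral_thompson hψ t p.2 x (hf p x)))
  have hgapm (p : 𝒪 × History 𝒳 𝒜 t) (x) : Measurable fun a => Φ.gap ρ p.1 p.2 (x, a) ^ 2 :=
    ((Φ.measurable_gap ρ).comp (f := fun a => (p.1, p.2, x, a)) (by fun_prop)).pow_const 2
  rw [hplay (fun p x a => Φ.meanReward (x, a, p.1)) (fun p x => by fun_prop),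
    hplay (fun p x a => Φ.gap ρ p.1 p.2 (x, a) ^ 2) hgapm, ← sub_le_iff_le_add]
  have hsum : ∫ p, ∫ x, (A (p.1, p.2, x) - B (p.1, p.2, x) - c * D (p.1, p.2, x)) ∂Φ.context ∂ρ =
      ∫ p, ∫ x, A (p.1, p.2, x) ∂Φ.context ∂ρ - ∫ p, ∫ x, B (p.1, p.2, x) ∂Φ.context ∂ρ
        - c * ∫ p, ∫ x, D (p.1, p.2, x) ∂Φ.context ∂ρ := by
    rw [← integral_prod _ hiA, ← integral_prod _ hiB, ← integral_prod _ hiD,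
      ← integral_const_mul, ← integral_sub hiA hiB]
    exact (integral_prod _ ((hiA.sub hiB).sub (hiD.const_mul c))).symm.trans
      (integral_sub (hiA.sub hiB) (hiD.const_mul c))
  refine hsum.symm.le.trans ?_
  -- Conditioning on history and context reduces the claim to the pointwise bound `hpt`.
  rw [integral_integral_posterior ρ Φ.context
    (G := fun θ h x => A (θ, h, x) - B (θ, h, x) - c * D (θ, h, x)) (by fun_prop)
    (fun θ h x => hAi _)]
  have hpt (h : History 𝒳 𝒜 t) (x : 𝒳) :
      ∫ θ, (A (θ, h, x) - B (θ, h, x) - c * D (θ, h, x)) ∂posterior ρ h ≤ 1 / (2 * η) :=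
    integral_regret_le hm ρ h x (fun θ => ψ (x, θ)) hη
  exact integral_le_of_forall_le (by positivity) fun p =>
    integral_le_of_forall_le (by positivity) fun x => hpt p.2 x

theorem RewardBounded.regret_thompson_le [MeasurableSingletonClass 𝒜]
    (hm : ∀ x a θ, Φ.meanReward (x, a, θ) = inner ℝ (v θ) (m (x, a)))
    (T : ℕ) {ψ : 𝒳 × 𝒪 → 𝒜} (hψ : Φ.IsOptimal T ψ) :
    Φ.regret T (Φ.thompson ψ hψ.measurable) ≤
      √(T * (Module.finrank ℝ E * (L ^ 2 * Real.log (Fintype.card 𝒪) / 2))) := by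
  have hlog : 0 ≤ Real.log (Fintype.card 𝒪) := Real.log_natCast_nonneg _
  refine le_sqrt_of_forall_le_div_add_mul (by positivity) (by positivity) fun η hη => ?_
  rw [regret, hψ.optimalReward_eq, hL.cumulativeReward_oracle hψ.measurable
    ((Φ.thompson ψ hψ.measurable).blind 𝒪), hL.cumulativeReward_eq_sum, ← Finset.sum_sub_distrib]
  refine (Finset.sum_le_sum fun t _ =>
    hL.round_regret_le hm hψ.measurable t hη rfl).trans ?_
  rw [Finset.sum_add_distrib, ← Finset.mul_sum, ← mul_assoc (η / 2)]
  refine add_le_add (le_of_eq ?_) (mul_le_mul_of_nonneg_left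
    (hL.sum_integral_gap_sq_le (Φ.thompson ψ hψ.measurable) T) (by positivity))
  simp only [Finset.sum_const, Finset.card_range, nsmul_eq_mul]
  ring

end ContextualBandit

theorem corollary3 {d : ℕ} {𝒳 𝒜 : Type*} [MeasurableSpace 𝒳]
    [MeasurableSpace 𝒜] [MeasurableSingletonClass 𝒜] [Finite 𝒜]
    (O : Finset (EuclideanSpace ℝ (Fin d))) [Nonempty O]
    (Φ : ContextualBandit 𝒳 𝒜 O) (L : ℝ)
    (hL : ∀ x a θ, ∀ᵐ r ∂(Φ.reward (x, a, θ)), r ∈ Set.Icc 0 L)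
    (m : 𝒳 × 𝒜 → EuclideanSpace ℝ (Fin d))
    (hm : ∀ x a (θ : O), ∫ r, r ∂(Φ.reward (x, a, θ)) =
      inner ℝ (θ : EuclideanSpace ℝ (Fin d)) (m (x, a)))
    (T : ℕ) (ψ : 𝒳 × O → 𝒜) (hψ : Φ.IsOptimal T ψ) :
    Φ.regret T (Φ.thompson ψ hψ.measurable) ≤
      Real.sqrt (L ^ 2 * d * T * Real.log O.card / 2) := by
  have hL' : Φ.RewardBounded L := fun y => hL y.1 y.2.1 y.2.2
  refine (hL'.regret_thompson_le (v := fun θ : O => (θ : EuclideanSpace ℝ (Fin d))) (m := m) hm T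
    hψ).trans (le_of_eq ?_)
  rw [finrank_euclideanSpace_fin, Fintype.card_coe]
  congr 1
  ring
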